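/- Let $q$ be a prime power and $\mathbb F_q$ the field with $q$ elements. For subspaces $U,V$ of $\mathbb F_q^n$ let $d_S(U,V)=\dim U+\dim V-2\dim(U\cap V)$. An $(n,d,k)_q$ constant dimension code is a set $\mathscr C$ of $k$-dimensional subspaces of $\mathbb F_q^n$ with $\min\{d_S(U,V) : U,V\in\mathscr C,\ U\neq V\}=d$. A linear $[k\times(n-k),\delta]_q$ MRD code is an $\mathbb F_q$-linear subspace $\mathcal D$ of $\mathbb F_q^{k\times(n-k)}$ such that $\operatorname{rank}(A-B)\ge\delta$ for all distinct $A,B\in\mathcal D$ and $|\mathcal D|=q^{\max\{k,n-k\}(\min\{k,n-k\}-\delta+1)}$; the corresponding lifted MRD code is $\{\operatorname{rowspace}(I_k\mid A) : A\in\mathcal D\}$. Let $\overline A_q(n,2\delta,k)$ denote the maximum size of an $(n,2\delta,k)_q$ constant dimension code that contains, as a subset, the lifted MRD code of some linear $[k\times(n-k),\delta]_q$ MRD code. Then $$\overline A_q(17,8,6)\ \ge\ \begin{cases} q^{33}+q^{21}+q^{17}+q^{15}+4q^{14}+4q^{13}+q^{12}+q^{10}+q^{9}+2q^{6}+q^{4}+1,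 & \text{if } q>2,\\[2pt] q^{33}+q^{21}+q^{17}+q^{15}+4q^{14}+q^{13}+q^{10}+q^{9}+2q^{6}+q^{4}+1, & \text{if } q=2.\end{cases}$$ -/

import Mathlib

/-- The subspace distance `d_S(U,V) = dim U + dim V - 2 dim (U ∩ V)` on subspaces of `F^n`.
The subtraction never truncates, since `dim (U ∩ V)` is at most `dim U` and at most `dim V`. -/
noncomputable def subspaceDist {F : Type*} [Field F] {n : ℕ}
    (U V : Submodule F (Fin n → F)) : ℕ :=
  Module.finrank F U + Module.finrank F V - 2 * Module.finrank F (U ⊓ V : Submodule F (Fin n → F))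

/-- `C` is a constant dimension code with parameters `(n, |C|, d, k)`: a set of `k`-dimensional
subspaces of `F^n` whose minimum subspace distance between distinct members is exactly `d`. -/
def IsCDC {F : Type*} [Field F] (n d k : ℕ) (C : Set (Submodule F (Fin n → F))) : Prop :=
  (∀ U ∈ C, Module.finrank F U = k) ∧
    IsLeast {e : ℕ | ∃ U ∈ C, ∃ V ∈ C, U ≠ V ∧ e = subspaceDist U V} d

/-- `D` is a linear `m × r` maximum rank distance code with distance `δ`: distinct members have
rank distance at least `δ`, and `|D| = q ^ (max m r * (min m r - δ + 1))` attains the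
Singleton-like bound, where `q = |F|`. -/
def IsLinearMRD {F : Type*} [Field F] {m r : ℕ} (δ : ℕ)
    (D : Submodule F (Matrix (Fin m) (Fin r) F)) : Prop :=
  (∀ A ∈ D, ∀ B ∈ D, A ≠ B → δ ≤ (A - B).rank) ∧
    Nat.card D = Nat.card F ^ (max m r * (min m r + 1 - δ))

/-- The `k × n` block matrix `(I_k | A)`, for a `k × (n - k)` matrix `A`. -/
def idAppend {F : Type*} [Field F] {n k : ℕ} (A : Matrix (Fin k) (Fin (n - k)) F) :
    Matrix (Fin k) (Fin n) F :=
  Matrix.of fun i j =>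
    if h : (j : ℕ) < k then (1 : Matrix (Fin k) (Fin k) F) i ⟨j, h⟩
    else A i ⟨j - k, by omega⟩

/-- The row space of `(I_k | A)`. -/
def liftMatrix {F : Type*} [Field F] {n k : ℕ} (A : Matrix (Fin k) (Fin (n - k)) F) :
    Submodule F (Fin n → F) :=
  Submodule.span F (Set.range (idAppend A).row)

/-- The sizes of the `(n, 2δ, k)` constant dimension codes over `F`, where `d = 2δ`, that contain
as a subset the lifting of some `k × (n - k)` MRD code with rank distance `δ`. -/
def cdcSizesWithLiftedMRD (F : Type*) [Field F] (n d k : ℕ) : Set ℕ :=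
  {M : ℕ | ∃ C : Set (Submodule F (Fin n → F)), IsCDC n d k C ∧ C.ncard = M ∧
    ∃ (δ : ℕ) (D : Submodule F (Matrix (Fin k) (Fin (n - k)) F)),
      d = 2 * δ ∧ IsLinearMRD δ D ∧ liftMatrix '' (D : Set (Matrix (Fin k) (Fin (n - k)) F)) ⊆ C}

/-- Over a finite field these sizes are bounded, so that their supremum is a maximum. -/
theorem bddAbove_cdcSizesWithLiftedMRD (F : Type*) [Field F] [Finite F] (n d k : ℕ) :
    BddAbove (cdcSizesWithLiftedMRD F n d k) := by
  have : Finite (Submodule F (Fin n → F)) :=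
    Finite.of_injective (fun U : Submodule F (Fin n → F) => (U : Set (Fin n → F)))
      SetLike.coe_injective
  refine ⟨Nat.card (Submodule F (Fin n → F)), ?_⟩
  rintro M ⟨C, -, rfl, -⟩
  exact Set.ncard_le_card C

/-- `Abar F n d k` is the maximum size of an `(n, d, k)` constant dimension code over `F`
that contains a lifted MRD code as a subset. -/
noncomputable def Abar (F : Type*) [Field F] (n d k : ℕ) : ℕ :=
  sSup (cdcSizesWithLiftedMRD F n d k)

/-! The lifted `6 × 11` MRD code of rank distance 4 supplies `q ^ 33` subspaces. More are added as
row spaces of matrices with pivots 0, 1 in the upper two rows, a block `L` in columns 2 to 5, and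
four lower rows that vanish in columns 0 to 5. Any two distinct codewords must meet in dimension at
most 2.

A lifted codeword and an added one: a common vector is determined by coordinates 0, 1, since
otherwise its leading position would be beyond the head. Same pattern: fillings have rank distance
4. Different patterns: differences of blocks `L` have rank 2, which kills the upper coefficients of
a common vector; its leading position is then a lower pivot of both patterns, and two patterns share
at most two of these.

Fillings come from a `6 × m` MRD code of dimension `3 * m` by imposing the echelon zeros on the
lower rows only, at most one dimension lost per zero. Summing over sixteen patterns gives slightly
more than the claim. -/

/-! ### Linear MRD codes from linearized polynomials -/

section Gabidulin

open Module Polynomial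

variable {F K : Type*} [Field F] [Fintype F] [Field K] [Algebra F K]

/-- The `F`-linear map `x ↦ ∑ j, c j * x ^ q ^ j` on an extension of the field `F` with `q`
elements. -/
noncomputable def linearizedMap {t : ℕ} (c : Fin t → K) : K →ₗ[F] K :=
  ∑ j, LinearMap.mulLeft F (c j) ∘ₗ (FiniteField.frobeniusAlgHom F K ^ (j : ℕ)).toLinearMap

theorem linearizedMap_apply {t : ℕ} (c : Fin t → K) (x : K) :
    linearizedMap (F := F) c x = ∑ j, c j * x ^ Fintype.card F ^ (j : ℕ) := by
  simp only [linearizedMap, LinearMap.sum_apply, LinearMap.comp_apply, LinearMap.mulLeft_apply,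
    AlgHom.toLinearMap_apply, AlgHom.coe_pow, FiniteField.coe_frobeniusAlgHom, pow_iterate]

/-- A nonzero linearized polynomial of `q`-degree less than `t` vanishes on no `t`-dimensional
space. -/
theorem finrank_lt_of_linearizedMap_eq_zero [Module.Finite F K] {t : ℕ} {c : Fin t → K}
    (hc : c ≠ 0) (V : Submodule F K) (hV : ∀ x ∈ V, linearizedMap (F := F) c x = 0) :
    finrank F V < t := by
  classical
  set q := Fintype.card F with hq
  have hq1 : 1 < q := Fintype.one_lt_card
  have : Finite K := Module.finite_of_finite F
  -- The space consists of roots of `P`, so its `q ^ finrank F V` elements number at most the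
  -- degree.
  set P : K[X] := ∑ j : Fin t, monomial (q ^ (j : ℕ)) (c j) with hP
  obtain ⟨j₀, hj₀⟩ := Function.ne_iff.1 hc
  have hcoeff : P.coeff (q ^ (j₀ : ℕ)) = c j₀ := by
    simp [hP, finsetSum_coeff, coeff_monomial, (Nat.pow_right_injective hq1).eq_iff, Fin.val_inj]
  have hP0 : P ≠ 0 := fun h => hj₀ (by rw [← hcoeff, h]; simp)
  have hdeg : P.natDegree ≤ q ^ (t - 1) := by
    refine natDegree_sum_le_of_forall_le _ _ fun j _ => (natDegree_monomial_le _).trans ?_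
    exact Nat.pow_le_pow_right hq1.le (by omega)
  have hsub : (V : Set K) ⊆ P.roots.toFinset := by
    intro x hx
    have := hV x hx
    rw [linearizedMap_apply] at this
    have h0 : P.eval x = 0 := by
      rw [hP, eval_finsetSum]
      simpa using this
    simpa [hP0] using h0
  have hcard : q ^ finrank F V ≤ q ^ (t - 1) := by
    calc q ^ finrank F V = Nat.card V := by
          rw [Module.natCard_eq_pow_finrank (K := F), Nat.card_eq_fintype_card]
      _ = (V : Set K).ncard := rfl
      _ ≤ (P.roots.toFinset : Set K).ncard := Set.ncard_le_ncard hsub (Finset.finite_toSet _)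
      _ = P.roots.toFinset.card := Set.ncard_coe_finset _
      _ ≤ Multiset.card P.roots := Multiset.toFinset_card_le _
      _ ≤ P.natDegree := card_roots' P
      _ ≤ q ^ (t - 1) := hdeg
  have := (Nat.pow_le_pow_iff_right hq1).1 hcard
  -- This gives `0 < t`, so `t - 1` is not truncated.
  have := j₀.2
  omega

end Gabidulin

theorem Matrix.rank_add_finrank_ker_vecMulLinear {F ι κ : Type*} [Field F] [Fintype ι]
    [Fintype κ] (A : Matrix ι κ F) :
    A.rank + Module.finrank F (LinearMap.ker A.vecMulLinear) = Fintype.card ι := by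
  rw [Matrix.rank_eq_finrank_span_row, ← range_vecMulLinear,
    LinearMap.finrank_range_add_finrank_ker, Module.finrank_fintype_fun_eq_card]

/-- Existence of linear maximum rank distance codes (Delsarte, Gabidulin). -/
theorem exists_linear_mrd (F : Type*) [Field F] [Finite F] (ι κ : Type*) [Fintype ι] [Fintype κ]
    [Nonempty κ] (hle : Fintype.card ι ≤ Fintype.card κ) (t : ℕ) (ht : t ≤ Fintype.card ι) :
    ∃ D : Submodule F (Matrix ι κ F), Module.finrank F D = Fintype.card κ * t ∧
      ∀ A ∈ D, A ≠ 0 → Fintype.card ι + 1 ≤ A.rank + t := by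
  classical
  have := Fintype.ofFinite F
  obtain ⟨p, hp⟩ := CharP.exists F
  have : Fact p.Prime := ⟨CharP.char_is_prime F p⟩
  have : NeZero (Fintype.card κ) := ⟨Fintype.card_ne_zero⟩
  let K := FiniteField.Extension F p (Fintype.card κ)
  have hK : Module.finrank F K = Fintype.card κ := FiniteField.finrank_extension F p _
  let β : Module.Basis κ F K :=
    (Module.finBasisOfFinrankEq F K hK).reindex (Fintype.equivFin κ).symm
  obtain ⟨e⟩ : Nonempty (ι ↪ κ) := Function.Embedding.nonempty_of_card_le hle
  let a : ι → K := fun i => β (e i)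
  have ha : LinearIndependent F a := β.linearIndependent.comp e e.injective
  let ev : (Fin t → K) →ₗ[F] Matrix ι κ F :=
    { toFun := fun c => Matrix.of fun i k => β.repr (linearizedMap (F := F) c (a i)) k
      map_add' := fun c d => by
        ext i k
        simp [linearizedMap_apply, add_mul, Finset.sum_add_distrib]
      map_smul' := fun s c => by
        ext i k
        simp only [linearizedMap_apply, Pi.smul_apply, smul_mul_assoc, ← Finset.smul_sum,
          map_smul, Matrix.of_apply, Matrix.smul_apply, Finsupp.smul_apply, RingHom.id_apply] }
  have hev : ∀ (c : Fin t → K) (x : ι → F),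
      Matrix.vecMul x (ev c) = β.repr (linearizedMap (F := F) c (∑ i, x i • a i)) := by
    intro c x
    ext k
    simp [Matrix.vecMul, dotProduct, ev, map_sum]
  have hrank : ∀ c : Fin t → K, c ≠ 0 → Fintype.card ι + 1 ≤ (ev c).rank + t := by
    intro c hc
    have hinj : Function.Injective (Fintype.linearCombination F a) :=
      linearIndependent_iff_injective_fintypeLinearCombination.1 ha
    have h1 := Matrix.rank_add_finrank_ker_vecMulLinear (ev c)
    -- The left kernel of `ev c` embeds in `K` as a space of zeros of the linearized map, because
    -- the `a i` are independent.
    have h2 := finrank_lt_of_linearizedMap_eq_zero (F := F) hc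
      ((LinearMap.ker (ev c).vecMulLinear).map (Fintype.linearCombination F a)) (by
        rintro _ ⟨x, hx, rfl⟩
        have hx' : Matrix.vecMul x (ev c) = 0 := hx
        rw [hev] at hx'
        have : β.repr (linearizedMap (F := F) c (∑ i, x i • a i)) = 0 :=
          DFunLike.coe_injective hx'
        simpa only [Fintype.linearCombination_apply, map_eq_zero_iff _ β.repr.injective] using this)
    rw [← (Submodule.equivMapOfInjective _ hinj _).finrank_eq] at h2
    omega
  have hinj : Function.Injective ev := by
    rw [injective_iff_map_eq_zero]
    intro c hc
    by_contra h
    have := hrank c h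
    rw [hc, Matrix.rank_zero] at this
    omega
  refine ⟨LinearMap.range ev, ?_, ?_⟩
  · rw [LinearMap.finrank_range_of_inj hinj, Module.finrank_pi_fintype]
    simp [hK, mul_comm]
  · rintro _ ⟨c, rfl⟩ h
    exact hrank c (fun h0 => h (by rw [h0, map_zero]))

/-! ### Row spaces with prescribed pivot columns -/

section RowSpaces

open Module

variable {F ι κ : Type*} [Field F] [Fintype ι]

theorem mem_span_range_row {G : Matrix ι κ F} {y : κ → F} :
    y ∈ Submodule.span F (Set.range G.row) ↔ ∃ x, Matrix.vecMul x G = y := by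
  rw [← range_vecMulLinear]
  rfl

/-- A space of vectors that is determined by the coordinates in `s` has dimension at most `|s|`. -/
theorem finrank_le_card_of_coords [Fintype κ] (V : Submodule F (κ → F)) (s : Finset κ)
    (h : ∀ y ∈ V, (∀ j ∈ s, y j = 0) → y = 0) : finrank F V ≤ s.card := by
  have hinj : Function.Injective ((LinearMap.funLeft F F (Subtype.val : s → κ)).domRestrict V) := by
    rw [injective_iff_map_eq_zero]
    intro y hy
    exact Subtype.ext (h y y.2 fun j hj => congrFun hy ⟨j, hj⟩)
  simpa using LinearMap.finrank_le_finrank_of_injective hinj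

theorem vecMul_pivot [DecidableEq ι] {G : Matrix ι κ F} {p : ι → κ} (hG : G.submatrix id p = 1)
    (x : ι → F) (i : ι) : Matrix.vecMul x G (p i) = x i := by
  have : Matrix.vecMul x (G.submatrix id p) i = x i := by rw [hG, Matrix.vecMul_one]
  exact this

theorem finrank_span_range_row_of_pivots [DecidableEq ι] [Fintype κ] {G : Matrix ι κ F}
    {p : ι → κ} (hG : G.submatrix id p = 1) :
    finrank F (Submodule.span F (Set.range G.row)) = Fintype.card ι := by
  rw [← range_vecMulLinear, LinearMap.finrank_range_of_inj, finrank_fintype_fun_eq_card]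
  intro x x' h
  ext i
  rw [← vecMul_pivot hG x, ← vecMul_pivot hG x']
  exact congrFun h (p i)

/-- Row spaces of matrices with the same pivot columns meet in a space whose dimension is
controlled by the rank distance. -/
theorem finrank_inf_add_rank_le [DecidableEq ι] [Fintype κ] {G G' : Matrix ι κ F}
    {p : ι → κ} (hG : G.submatrix id p = 1) (hG' : G'.submatrix id p = 1) :
    finrank F (Submodule.span F (Set.range G.row) ⊓ Submodule.span F (Set.range G'.row) :
      Submodule F (κ → F)) + (G - G').rank ≤ Fintype.card ι := by
  have hle : Submodule.span F (Set.range G.row) ⊓ Submodule.span F (Set.range G'.row) ≤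
      (LinearMap.ker (G - G').vecMulLinear).map G.vecMulLinear := by
    rintro y ⟨hy, hy'⟩
    obtain ⟨x, rfl⟩ := mem_span_range_row.1 hy
    obtain ⟨x', hx'⟩ := mem_span_range_row.1 hy'
    have hxx : x' = x := by
      ext i
      rw [← vecMul_pivot hG' x', hx', vecMul_pivot hG]
    refine ⟨x, ?_, rfl⟩
    rw [hxx] at hx'
    change Matrix.vecMul x (G - G') = 0
    rw [Matrix.vecMul_sub, hx', sub_self]
  have h1 := (Submodule.finrank_mono hle).trans (Submodule.finrank_map_le _ _)
  have h2 := (G - G').rank_add_finrank_ker_vecMulLinear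
  omega

theorem rank_submatrix_cols_le {ι κ μ : Type*} [Fintype κ] [Fintype μ] (A : Matrix ι κ F)
    (f : μ → κ) : (A.submatrix id f).rank ≤ A.rank := by
  classical
  have : A.submatrix id f = A * (1 : Matrix κ κ F).submatrix id f := by
    ext i j
    simp [Matrix.mul_apply, Matrix.one_apply]
  rw [this]
  exact Matrix.rank_mul_le_left _ _

end RowSpaces

/-! ### Lifted matrices -/

section LiftedMatrices

variable {F : Type*} [Field F] {n k : ℕ}

theorem idAppend_submatrix_castLE (h : k ≤ n) (A : Matrix (Fin k) (Fin (n - k)) F) :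
    (idAppend A).submatrix id (Fin.castLE h) = 1 := by
  ext i j
  simp [idAppend]
  rfl

theorem vecMul_idAppend_of_head_eq_zero (h : k ≤ n) {A : Matrix (Fin k) (Fin (n - k)) F}
    {x : Fin k → F} (hx : ∀ j : Fin n, (j : ℕ) < k → Matrix.vecMul x (idAppend A) j = 0) :
    x = 0 := by
  ext i
  rw [← vecMul_pivot (idAppend_submatrix_castLE h A) x]
  exact hx _ i.2

theorem finrank_liftMatrix (h : k ≤ n) (A : Matrix (Fin k) (Fin (n - k)) F) :
    Module.finrank F (liftMatrix A) = k := by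
  rw [liftMatrix, finrank_span_range_row_of_pivots (idAppend_submatrix_castLE h A),
    Fintype.card_fin]

theorem finrank_liftMatrix_inf_add_rank_le (h : k ≤ n) (A B : Matrix (Fin k) (Fin (n - k)) F) :
    Module.finrank F (liftMatrix A ⊓ liftMatrix B : Submodule F (Fin n → F)) + (A - B).rank ≤
      k := by
  have h1 := finrank_inf_add_rank_le (idAppend_submatrix_castLE h A)
    (idAppend_submatrix_castLE h B)
  have h2 : A - B = (idAppend A - idAppend B).submatrix id
      (fun j : Fin (n - k) => (⟨k + j, by omega⟩ : Fin n)) := by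
    ext i j
    simp [idAppend]
  have h3 := rank_submatrix_cols_le (idAppend A - idAppend B)
      (fun j : Fin (n - k) => (⟨k + j, by omega⟩ : Fin n))
  rw [← h2] at h3
  rw [Fintype.card_fin] at h1
  exact (Nat.add_le_add_left h3 _).trans h1

end LiftedMatrices

/-! ### The added codewords and their intersections -/

section Frames

open Module

variable {F : Type*} [Field F]

/-- The row indices of the two upper rows. -/
abbrev UpperRow : Type := {i : Fin 6 // i < 2}

/-- The column indices of the block to the right of the two leading pivots. -/
abbrev HeadCol : Type := {j : Fin 17 // 2 ≤ j ∧ j < 6}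

/-- The nonpivot columns beyond column `6`. -/
def nonpivots (p : Fin 6 → Fin 17) : Finset (Fin 17) :=
  Finset.univ.filter fun j => 6 < j ∧ ∀ i, p i ≠ j

/-- The positions in a nonpivot column and one of the lower rows that are left of the pivot. -/
def forcedZeros (p : Fin 6 → Fin 17) : Finset (Fin 6 × Fin 17) :=
  Finset.univ.filter fun z => 2 ≤ z.1 ∧ z.2 ∈ nonpivots p ∧ z.2 < p z.1

/-- Pivot columns `0, 1` for the upper rows and distinct ones from `6` on for the lower rows. -/
structure IsPivotPattern (p : Fin 6 → Fin 17) : Prop where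
  zero : p 0 = 0
  one : p 1 = 1
  six_le : ∀ i, 2 ≤ i → 6 ≤ p i
  injective : Function.Injective p

/-- The generator matrix with pivot columns `p`, block `L` in the head and block `N` in the
nonpivot columns. -/
def frameMatrix (p : Fin 6 → Fin 17) (L : Matrix UpperRow HeadCol F)
    (N : Matrix (Fin 6) (nonpivots p) F) : Matrix (Fin 6) (Fin 17) F :=
  Matrix.of fun i j =>
    if h : j ∈ nonpivots p then N i ⟨j, h⟩
    else if h : i < 2 ∧ 2 ≤ j ∧ j < 6 then L ⟨i, h.1⟩ ⟨j, h.2⟩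
    else if j = p i then 1 else 0

/-- The zero pattern of reduced echelon matrices in the lower rows. -/
def IsEchelonFilling (p : Fin 6 → Fin 17) (N : Matrix (Fin 6) (nonpivots p) F) : Prop :=
  ∀ i, 2 ≤ i → ∀ j : nonpivots p, (j : Fin 17) < p i → N i j = 0

variable {p : Fin 6 → Fin 17} {L : Matrix UpperRow HeadCol F}
  {N : Matrix (Fin 6) (nonpivots p) F}

theorem IsPivotPattern.head_or_tail (hp : IsPivotPattern p) (i : Fin 6) :
    p i < 2 ∨ 6 ≤ p i := by
  rcases lt_or_ge i 2 with h | h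
  · left
    have : i = 0 ∨ i = 1 := by omega
    rcases this with rfl | rfl
    · rw [hp.zero]; decide
    · rw [hp.one]; decide
  · exact Or.inr (hp.six_le i h)

theorem frameMatrix_pivots (hp : IsPivotPattern p) (L : Matrix UpperRow HeadCol F)
    (N : Matrix (Fin 6) (nonpivots p) F) : (frameMatrix p L N).submatrix id p = 1 := by
  ext i i'
  have h1 : p i' ∉ nonpivots p := by simp [nonpivots]
  have h2 : ¬(i < 2 ∧ 2 ≤ p i' ∧ p i' < 6) := by
    rintro ⟨-, h, h'⟩
    rcases hp.head_or_tail i' with h3 | h3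
    · exact absurd h (not_le.2 h3)
    · exact absurd h' (not_lt.2 h3)
  simp only [frameMatrix, Matrix.submatrix_apply, Matrix.of_apply, id, dif_neg h1, dif_neg h2,
    hp.injective.eq_iff, Matrix.one_apply, @eq_comm _ i' i]

theorem frameMatrix_lower (hN : IsEchelonFilling p N) {i : Fin 6} (hi : 2 ≤ i) {j : Fin 17}
    (hj : j < p i) : frameMatrix p L N i j = 0 := by
  simp only [frameMatrix, Matrix.of_apply, not_lt.2 hi, false_and, dite_false, if_neg hj.ne]
  split_ifs with h
  · exact hN i hi ⟨j, h⟩ hj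
  · rfl

theorem frameMatrix_head (i : UpperRow) (j : HeadCol) : frameMatrix p L N i j = L i j := by
  have h : (j : Fin 17) ∉ nonpivots p := by
    simp only [nonpivots, Finset.mem_filter, not_and]
    exact fun _ h => absurd j.2.2 (not_lt.2 h.le)
  simp only [frameMatrix, Matrix.of_apply, dif_neg h]
  rw [dif_pos ⟨i.2, j.2⟩]

theorem frameMatrix_sub_submatrix (N N' : Matrix (Fin 6) (nonpivots p) F) :
    (frameMatrix p L N - frameMatrix p L N').submatrix id (Subtype.val : nonpivots p → Fin 17) =
      N - N' := by
  ext i j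
  simp [frameMatrix, j.2]

/-- The row space of a frame matrix. -/
def frameSpace (p : Fin 6 → Fin 17) (L : Matrix UpperRow HeadCol F)
    (N : Matrix (Fin 6) (nonpivots p) F) : Submodule F (Fin 17 → F) :=
  Submodule.span F (Set.range (frameMatrix p L N).row)

theorem finrank_frameSpace (hp : IsPivotPattern p) (L : Matrix UpperRow HeadCol F)
    (N : Matrix (Fin 6) (nonpivots p) F) : finrank F (frameSpace p L N) = 6 := by
  rw [frameSpace, finrank_span_range_row_of_pivots (frameMatrix_pivots hp L N), Fintype.card_fin]

theorem finrank_frameSpace_inf_add_rank_le (hp : IsPivotPattern p)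
    (L : Matrix UpperRow HeadCol F) (N N' : Matrix (Fin 6) (nonpivots p) F) :
    finrank F (frameSpace p L N ⊓ frameSpace p L N' : Submodule F (Fin 17 → F)) +
      (N - N').rank ≤ 6 := by
  have h1 := finrank_inf_add_rank_le (frameMatrix_pivots hp L N) (frameMatrix_pivots hp L N')
  have h2 := rank_submatrix_cols_le (frameMatrix p L N - frameMatrix p L N')
    (Subtype.val : nonpivots p → Fin 17)
  rw [frameMatrix_sub_submatrix] at h2
  rw [Fintype.card_fin] at h1
  exact (Nat.add_le_add_left h2 _).trans h1

/-- A vector of a frame space that vanishes in the two leading coordinates vanishes left of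
column `6`, and its leading position is a pivot of a lower row. -/
theorem exists_pivot_of_isLeast (hp : IsPivotPattern p) (hN : IsEchelonFilling p N)
    {y : Fin 17 → F} (hy : y ∈ frameSpace p L N) (h0 : y 0 = 0) (h1 : y 1 = 0)
    {j : Fin 17} (hj : IsLeast {j | y j ≠ 0} j) : ∃ i, 2 ≤ i ∧ p i = j := by
  obtain ⟨x, rfl⟩ := mem_span_range_row.1 hy
  have hx : ∀ i, Matrix.vecMul x (frameMatrix p L N) (p i) = x i :=
    vecMul_pivot (frameMatrix_pivots hp L N) x
  have hj0 : ∑ i, x i * frameMatrix p L N i j ≠ 0 := hj.1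
  obtain ⟨i, -, hi⟩ := Finset.exists_ne_zero_of_sum_ne_zero hj0
  have hxi : x i ≠ 0 := left_ne_zero_of_mul hi
  have hi2 : 2 ≤ i := by
    by_contra h
    have : i = 0 ∨ i = 1 := by omega
    rcases this with rfl | rfl
    · exact hxi (by rw [← hx, hp.zero, h0])
    · exact hxi (by rw [← hx, hp.one, h1])
  -- The pivot `p i` lies in the support as `x i ≠ 0`, so `j ≤ p i`; row `i` vanishes left of its
  -- pivot, so `p i ≤ j`.
  refine ⟨i, hi2, le_antisymm ?_ (hj.2 ((hx i).trans_ne hxi))⟩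
  by_contra h
  exact right_ne_zero_of_mul hi (frameMatrix_lower hN hi2 (not_le.1 h))

theorem exists_isLeast_support {y : Fin 17 → F} (hy : y ≠ 0) :
    ∃ j, IsLeast {j | y j ≠ 0} j := by
  obtain ⟨j, hj⟩ := Function.ne_iff.1 hy
  obtain ⟨m, hm⟩ := (Set.toFinite {j | y j ≠ 0}).exists_minimal ⟨j, hj⟩
  exact ⟨m, hm.1, fun k hk => (le_total m k).elim id fun h => hm.2 hk h⟩

theorem finrank_liftMatrix_inf_frameSpace_le (hp : IsPivotPattern p) (hN : IsEchelonFilling p N)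
    (A : Matrix (Fin 6) (Fin (17 - 6)) F) :
    finrank F (liftMatrix A ⊓ frameSpace p L N : Submodule F (Fin 17 → F)) ≤ 2 := by
  refine finrank_le_card_of_coords _ {0, 1} fun y ⟨hyA, hy⟩ h => ?_
  by_contra hne
  obtain ⟨j, hj⟩ := exists_isLeast_support hne
  obtain ⟨i, hi, rfl⟩ := exists_pivot_of_isLeast hp hN hy (h 0 (by simp)) (h 1 (by simp)) hj
  obtain ⟨x, rfl⟩ := mem_span_range_row.1 hyA
  refine hne ?_
  have hx : x = 0 := vecMul_idAppend_of_head_eq_zero (show 6 ≤ 17 by decide) fun j hj6 => by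
    by_contra hj0
    have h6 : (6 : Fin 17) ≤ j := le_trans (hp.six_le i hi) (hj.2 hj0)
    exact absurd hj6 (not_lt.2 h6)
  rw [hx, Matrix.zero_vecMul]

/-- The positions that are pivots of lower rows for both patterns. -/
def commonPivots (p p' : Fin 6 → Fin 17) : Finset (Fin 17) :=
  (Finset.univ.filter (2 ≤ ·)).image p ∩ (Finset.univ.filter (2 ≤ ·)).image p'

theorem finrank_frameSpace_inf_le {p' : Fin 6 → Fin 17} (hp : IsPivotPattern p)
    (hp' : IsPivotPattern p') {L' : Matrix UpperRow HeadCol F}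
    (hL : ∀ x, Matrix.vecMul x (L - L') = 0 → x = 0) (hN : IsEchelonFilling p N)
    {N' : Matrix (Fin 6) (nonpivots p') F} (hN' : IsEchelonFilling p' N') :
    finrank F (frameSpace p L N ⊓ frameSpace p' L' N' : Submodule F (Fin 17 → F)) ≤
      (commonPivots p p').card := by
  refine finrank_le_card_of_coords _ _ fun y ⟨hy, hy'⟩ h => ?_
  -- Only the upper rows reach columns 2 to 5, and their coefficients are `y 0` and `y 1`, whatever
  -- the pattern.
  have hhead : ∀ {p : Fin 6 → Fin 17} {L : Matrix UpperRow HeadCol F}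
      {N : Matrix (Fin 6) (nonpivots p) F}, IsPivotPattern p → IsEchelonFilling p N →
      y ∈ frameSpace p L N → ∀ j : HeadCol,
      Matrix.vecMul (fun i : UpperRow => y (p i)) L j = y j := by
    intro p L N hp hN hy j
    obtain ⟨x, rfl⟩ := mem_span_range_row.1 hy
    have hx : ∀ i, Matrix.vecMul x (frameMatrix p L N) (p i) = x i :=
      vecMul_pivot (frameMatrix_pivots hp L N) x
    simp only [hx]
    have hz : ∀ i : Fin 6, ¬ i < 2 → x i * frameMatrix p L N i j = 0 := fun i hi => by
      rw [frameMatrix_lower hN (not_lt.1 hi) (j.2.2.trans_le (hp.six_le i (not_lt.1 hi))),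
        mul_zero]
    simp only [Matrix.vecMul, dotProduct]
    rw [← Fintype.sum_subtype_add_sum_subtype (fun i : Fin 6 => i < 2)
      (fun i => x i * frameMatrix p L N i j),
      Finset.sum_eq_zero (s := (Finset.univ : Finset {i : Fin 6 // ¬ i < 2}))
      (fun i _ => hz i i.2), add_zero]
    simp only [frameMatrix_head]
  have hpp : (fun i : UpperRow => y (p' i)) = fun i : UpperRow => y (p i) := by
    ext ⟨i, hi⟩
    have : i = 0 ∨ i = 1 := by omega
    rcases this with rfl | rfl
    · simp only [hp.zero, hp'.zero]
    · simp only [hp.one, hp'.one]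
  have hzero := hL (fun i : UpperRow => y (p i)) (by
    ext j
    have h1 := hhead hp hN hy j
    have h2 := hhead hp' hN' hy' j
    rw [hpp] at h2
    rw [Matrix.vecMul_sub, Pi.sub_apply, h1, h2, sub_self, Pi.zero_apply])
  have h0 : y 0 = 0 := by
    rw [← hp.zero]
    exact congrFun hzero ⟨0, by decide⟩
  have h1 : y 1 = 0 := by
    rw [← hp.one]
    exact congrFun hzero ⟨1, by decide⟩
  by_contra hne
  obtain ⟨j, hj⟩ := exists_isLeast_support hne
  obtain ⟨i, hi, hij⟩ := exists_pivot_of_isLeast hp hN hy h0 h1 hj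
  obtain ⟨i', hi', hij'⟩ := exists_pivot_of_isLeast hp' hN' hy' h0 h1 hj
  refine hj.1 (h j ?_)
  simp only [commonPivots, Finset.mem_inter, Finset.mem_image, Finset.mem_filter,
    Finset.mem_univ, true_and]
  exact ⟨⟨i, hi, hij⟩, ⟨i', hi', hij'⟩⟩

/-- A linear rank metric code of echelon fillings with rank distance `4`. -/
theorem exists_echelon_code (F : Type*) [Field F] [Finite F] (p : Fin 6 → Fin 17)
    (h6 : 6 ≤ (nonpivots p).card) :
    ∃ D : Submodule F (Matrix (Fin 6) (nonpivots p) F),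
      3 * (nonpivots p).card - (forcedZeros p).card ≤ finrank F D ∧
      (∀ N ∈ D, N ≠ 0 → 4 ≤ N.rank) ∧ ∀ N ∈ D, IsEchelonFilling p N := by
  have : Nonempty (nonpivots p) := (Finset.card_pos.1 (by omega)).to_subtype
  obtain ⟨D, hD, hrank⟩ := exists_linear_mrd F (Fin 6) (nonpivots p) (by simpa using h6) 3
    (by simp)
  rw [Fintype.card_coe] at hD
  rw [Fintype.card_fin] at hrank
  -- The code is the part of the MRD code on which the entries at the forced zeros vanish.
  let g : Matrix (Fin 6) (nonpivots p) F →ₗ[F] (forcedZeros p → F) :=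
    { toFun := fun N z => N z.1.1 ⟨z.1.2, (Finset.mem_filter.1 z.2).2.2.1⟩
      map_add' := fun _ _ => rfl
      map_smul' := fun _ _ => rfl }
  refine ⟨D ⊓ LinearMap.ker g, ?_, fun N hN h0 => ?_, fun N hN i hi j hj => ?_⟩
  · have h1 := LinearMap.finrank_range_add_finrank_ker (g.domRestrict D)
    have h2 : finrank F (LinearMap.range (g.domRestrict D)) ≤ (forcedZeros p).card := by
      simpa using (LinearMap.range (g.domRestrict D)).finrank_le
    have h3 : finrank F (LinearMap.ker (g.domRestrict D)) =
        finrank F (D ⊓ LinearMap.ker g : Submodule F _) := by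
      rw [LinearMap.ker_domRestrict, ← Submodule.map_comap_subtype,
        ← (Submodule.equivMapOfInjective _ D.injective_subtype _).finrank_eq]
    omega
  · have := hrank N hN.1 h0
    omega
  · exact congrFun (show g N = 0 from hN.2)
      ⟨(i, j), by simpa [forcedZeros, hi] using hj⟩

end Frames

/-! ### Patterns, code sizes and assembly -/

section Construction

open Module

/-- Sixteen pivot patterns: the first fourteen come from the blocks of a Steiner system
`S(3, 4, 8)` on the columns `6, …, 13`. -/
def pivotPattern : Fin 16 → Fin 6 → Fin 17 :=
  ![![0, 1, 6, 7, 8, 9], ![0, 1, 6, 7, 10, 11], ![0, 1, 6, 7, 12, 13], ![0, 1, 8, 9, 10, 11],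
    ![0, 1, 8, 9, 12, 13], ![0, 1, 10, 11, 12, 13], ![0, 1, 6, 8, 10, 12], ![0, 1, 6, 8, 11, 13],
    ![0, 1, 7, 9, 10, 12], ![0, 1, 7, 9, 11, 13], ![0, 1, 6, 9, 11, 12], ![0, 1, 6, 9, 10, 13],
    ![0, 1, 7, 8, 10, 13], ![0, 1, 7, 8, 11, 12], ![0, 1, 6, 7, 14, 15], ![0, 1, 6, 8, 14, 16]]

/-- The dimensions of the rank metric codes used with the patterns `pivotPattern`. -/
def codeDim : Fin 16 → ℕ := ![21, 17, 13, 14, 10, 6, 15, 13, 14, 12, 13, 13, 14, 14, 9, 7]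

theorem isPivotPattern_pivotPattern (s : Fin 16) : IsPivotPattern (pivotPattern s) where
  zero := by revert s; decide
  one := by revert s; decide
  six_le := by revert s; decide
  injective := by revert s; decide

/-- Seven nonpivots if 6 is a pivot, six otherwise. An unused column 6 is left out: it would add 3
to the dimension bound but force four zeros. -/
theorem six_le_card_nonpivots : ∀ s, 6 ≤ (nonpivots (pivotPattern s)).card := by decide

theorem codeDim_le : ∀ s, codeDim s ≤
    3 * (nonpivots (pivotPattern s)).card - (forcedZeros (pivotPattern s)).card := by
  decide +kernel

/-- Three points determine a block of the Steiner system; the last two patterns have only two points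
each in its columns and share only 6 and 14. -/
theorem card_commonPivots_le : ∀ s s', s ≠ s' →
    (commonPivots (pivotPattern s) (pivotPattern s')).card ≤ 2 := by
  decide +kernel

variable (F : Type*) [Field F] [Finite F]

/-- Sixteen blocks `L` such that the lines spanned by `(I ∣ L)` pairwise meet trivially. -/
theorem exists_head_blocks : ∃ L : Fin 16 → Matrix UpperRow HeadCol F,
    ∀ s s', s ≠ s' → ∀ x, Matrix.vecMul x (L s - L s') = 0 → x = 0 := by
  have h2 : Fintype.card UpperRow = 2 := by decide
  have h4 : Fintype.card HeadCol = 4 := by decide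
  have : Nonempty HeadCol := Fintype.card_pos_iff.1 (by omega)
  -- Rank 2 throughout and `q ^ 4 ≥ 16` elements: enough for sixteen patterns even when `q = 2`.
  obtain ⟨D, hD, hrank⟩ := exists_linear_mrd F UpperRow HeadCol (by omega) 1 (by omega)
  rw [h4] at hD
  rw [h2] at hrank
  have hcard : 16 ≤ Nat.card D := by
    rw [Module.natCard_eq_pow_finrank (K := F), hD]
    calc 16 = 2 ^ 4 := by norm_num
      _ ≤ Nat.card F ^ 4 := Nat.pow_le_pow_left Finite.one_lt_card 4
  have : Finite D := Module.finite_of_finite F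
  have := Fintype.ofFinite D
  obtain ⟨f⟩ : Nonempty (Fin 16 ↪ D) :=
    Function.Embedding.nonempty_of_card_le (by
      rwa [Fintype.card_fin, ← Nat.card_eq_fintype_card])
  refine ⟨fun s => f s, fun s s' hs x hx => ?_⟩
  have h1 := hrank _ (D.sub_mem (f s).2 (f s').2)
    (sub_ne_zero.2 fun h => hs (f.injective (Subtype.ext h)))
  have h3 := ((f s : Matrix UpperRow HeadCol F) - f s').rank_add_finrank_ker_vecMulLinear
  have h5 : LinearMap.ker ((f s : Matrix UpperRow HeadCol F) - f s').vecMulLinear = ⊥ :=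
    Submodule.finrank_eq_zero.1 (by omega)
  exact (Submodule.eq_bot_iff _).1 h5 x hx

/-- A `(17, 8, 6)` code that contains a lifted MRD code and has the size given by `codeDim`. -/
theorem exists_cdc : ∃ M ∈ cdcSizesWithLiftedMRD F 17 8 6,
    Nat.card F ^ 33 + ∑ s, Nat.card F ^ codeDim s ≤ M := by
  obtain ⟨D, hD, hDrank⟩ := exists_linear_mrd F (Fin 6) (Fin (17 - 6)) (by simp) 3 (by simp)
  rw [Fintype.card_fin] at hD hDrank
  obtain ⟨L, hL⟩ := exists_head_blocks F
  choose E hEdim hErank hE using fun s =>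
    exists_echelon_code F (pivotPattern s) (six_le_card_nonpivots s)
  let Φ : D ⊕ (Σ s, E s) → Submodule F (Fin 17 → F) :=
    Sum.elim (fun A => liftMatrix (A : Matrix (Fin 6) (Fin (17 - 6)) F))
      fun x => frameSpace (pivotPattern x.1) (L x.1) x.2
  have hpat := isPivotPattern_pivotPattern
  have hdim : ∀ x, finrank F (Φ x) = 6 := by
    rintro (A | ⟨s, N⟩)
    · exact finrank_liftMatrix (show 6 ≤ 17 by decide) _
    · exact finrank_frameSpace (hpat s) _ _
  have hinf : ∀ x y, x ≠ y → finrank F (Φ x ⊓ Φ y : Submodule F (Fin 17 → F)) ≤ 2 := by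
    rintro (A | ⟨s, N⟩) (B | ⟨s', N'⟩) hxy
    · have h1 := finrank_liftMatrix_inf_add_rank_le (show 6 ≤ 17 by decide)
        (A : Matrix (Fin 6) (Fin (17 - 6)) F) B
      have h2 := hDrank _ (D.sub_mem A.2 B.2)
        (sub_ne_zero.2 fun h => hxy (congrArg _ (Subtype.ext h)))
      change finrank F (liftMatrix (A : Matrix (Fin 6) (Fin (17 - 6)) F) ⊓ liftMatrix B.1 :
        Submodule F (Fin 17 → F)) ≤ 2
      omega
    · exact finrank_liftMatrix_inf_frameSpace_le (hpat s') (hE s' _ N'.2) _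
    · rw [inf_comm]
      exact finrank_liftMatrix_inf_frameSpace_le (hpat s) (hE s _ N.2) _
    · by_cases hs : s = s'
      · subst hs
        have h1 := finrank_frameSpace_inf_add_rank_le (hpat s) (L s) N.1 N'.1
        have h2 := hErank s _ ((E s).sub_mem N.2 N'.2)
          (sub_ne_zero.2 fun h => hxy (by rw [Subtype.ext h]))
        change finrank F (frameSpace (pivotPattern s) (L s) N.1 ⊓
          frameSpace (pivotPattern s) (L s) N'.1 : Submodule F (Fin 17 → F)) ≤ 2
        omega
      · exact (finrank_frameSpace_inf_le (hpat s) (hpat s') (hL s s' hs) (hE s _ N.2)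
          (hE s' _ N'.2)).trans (card_commonPivots_le s s' hs)
  have hinj : Function.Injective Φ := by
    intro x y hxy
    by_contra hne
    have := hinf x y hne
    rw [hxy, inf_idem, hdim] at this
    omega
  have hfinD : Finite D := Module.finite_of_finite F
  have hfinE : ∀ s, Finite (E s) := fun s => Module.finite_of_finite F
  have hcardD : Nat.card D = Nat.card F ^ 33 := by
    rw [Module.natCard_eq_pow_finrank (K := F), hD]
  refine ⟨(Set.range Φ).ncard, ⟨Set.range Φ, ⟨?_, ?_, ?_⟩, rfl, 4, D, rfl, ⟨?_, ?_⟩, ?_⟩, ?_⟩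
  · rintro _ ⟨x, rfl⟩
    exact hdim x
  · let x : D ⊕ (Σ s, E s) := Sum.inr ⟨0, 0⟩
    let y : D ⊕ (Σ s, E s) := Sum.inr ⟨1, 0⟩
    have hxy : x ≠ y := by
      intro h
      simp [x, y] at h
    refine ⟨Φ x, ⟨x, rfl⟩, Φ y, ⟨y, rfl⟩, hinj.ne hxy, ?_⟩
    have hmem : ∀ (s : Fin 16) (i : Fin 6) (j : Fin 17), 2 ≤ i → pivotPattern s i = j →
        Pi.single j 1 ∈ frameSpace (pivotPattern s) (L s) (0 : E s).1 := by
      intro s i j hi hj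
      refine Submodule.subset_span ⟨i, ?_⟩
      ext k
      simp [frameMatrix, Matrix.row, not_lt.2 hi, hj, Pi.single_apply]
      rintro hk rfl
      exact (Finset.mem_filter.1 hk).2.2 i hj
    have hle : Submodule.span F (Set.range
        fun j : Fin 2 => (Pi.single (![6, 7] j : Fin 17) 1 : Fin 17 → F)) ≤ Φ x ⊓ Φ y := by
      rw [Submodule.span_le]
      rintro _ ⟨j, rfl⟩
      fin_cases j
      · exact ⟨hmem 0 2 6 (by decide) (by decide), hmem 1 2 6 (by decide) (by decide)⟩
      · exact ⟨hmem 0 3 7 (by decide) (by decide), hmem 1 3 7 (by decide) (by decide)⟩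
    have hli : LinearIndependent F
        fun j : Fin 2 => (Pi.single (![6, 7] j : Fin 17) 1 : Fin 17 → F) :=
      (Pi.linearIndependent_single_one (Fin 17) F).comp ![6, 7] (by decide)
    have h1 := Submodule.finrank_mono hle
    rw [finrank_span_eq_card hli, Fintype.card_fin] at h1
    have h2 := hinf x y hxy
    rw [subspaceDist, hdim, hdim]
    omega
  · rintro _ ⟨_, ⟨x, rfl⟩, _, ⟨y, rfl⟩, hxy, rfl⟩
    have := hinf x y fun h => hxy (congrArg Φ h)
    rw [subspaceDist, hdim, hdim]
    omega
  · intro A hA B hB hAB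
    have := hDrank _ (D.sub_mem hA hB) (sub_ne_zero.2 hAB)
    omega
  · rw [hcardD]
    norm_num
  · rintro _ ⟨A, hA, rfl⟩
    exact ⟨Sum.inl ⟨A, hA⟩, rfl⟩
  · have hcard : (Set.range Φ).ncard = Nat.card D + ∑ s, Nat.card (E s) := by
      rw [← Nat.card_coe_set_eq, Nat.card_range_of_injective hinj, Nat.card_sum, Nat.card_sigma]
    rw [hcard, hcardD]
    refine Nat.add_le_add_left (Finset.sum_le_sum fun s _ => ?_) _
    rw [Module.natCard_eq_pow_finrank (K := F) (V := E s)]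
    exact Nat.pow_le_pow_right Finite.one_lt_card.le ((codeDim_le s).trans (hEdim s))

theorem sum_pow_codeDim (q : ℕ) : ∑ s, q ^ codeDim s =
    q ^ 21 + q ^ 17 + q ^ 15 + 4 * q ^ 14 + 4 * q ^ 13 + q ^ 12 + q ^ 10 + q ^ 9 + q ^ 7 +
      q ^ 6 := by
  simp only [Fin.sum_univ_succ, codeDim, Fin.sum_univ_zero, Matrix.cons_val_zero,
    Matrix.cons_val_succ]
  ring

/-- Trades the two smallest codes, of sizes `q ^ 7` and `q ^ 6`, for the tail of the stated bound.
-/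
theorem low_order_le {q : ℕ} (hq : 2 ≤ q) : 2 * q ^ 6 + q ^ 4 + 1 ≤ q ^ 7 + q ^ 6 := by
  have h4 : 1 ≤ q ^ 4 := Nat.one_le_pow _ _ (by omega)
  have h6 : 2 ^ 2 * q ^ 4 ≤ q ^ 2 * q ^ 4 := Nat.mul_le_mul_right _ (Nat.pow_le_pow_left hq 2)
  have h7 : 2 * q ^ 6 ≤ q * q ^ 6 := Nat.mul_le_mul_right _ hq
  rw [← pow_add] at h6
  rw [← pow_succ'] at h7
  norm_num only at h6 h7
  linarith

end Construction

theorem corollary3p5 (F : Type*) [Field F] [Finite F] (q : ℕ) (hq : Nat.card F = q) :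
    (2 < q →
      q ^ 33 + q ^ 21 + q ^ 17 + q ^ 15 + 4 * q ^ 14 + 4 * q ^ 13 + q ^ 12 + q ^ 10 + q ^ 9
        + 2 * q ^ 6 + q ^ 4 + 1 ≤ Abar F 17 8 6) ∧
    (q = 2 →
      q ^ 33 + q ^ 21 + q ^ 17 + q ^ 15 + 4 * q ^ 14 + q ^ 13 + q ^ 10 + q ^ 9
        + 2 * q ^ 6 + q ^ 4 + 1 ≤ Abar F 17 8 6) := by
  obtain ⟨M, hM, hle⟩ := exists_cdc F
  have hA : M ≤ Abar F 17 8 6 := le_csSup (bddAbove_cdcSizesWithLiftedMRD F 17 8 6) hM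
  have hlow := low_order_le (q := q) (hq ▸ Finite.one_lt_card)
  rw [hq, sum_pow_codeDim] at hle
  have key := hle.trans hA
  generalize Abar F 17 8 6 = a at key
  constructor <;> intro _
  · linarith
  -- For `q = 2` the claim is weaker: `3 * q ^ 13 + q ^ 12` is discarded.
  · have := Nat.zero_le (q ^ 13)
    have := Nat.zero_le (q ^ 12)
    linarith
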